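/- Notation. For integers $e_1,\dots,e_r\ge 2$ ($r\ge 1$) let $[e_1,\dots,e_r]=e_1-\cfrac{1}{e_2-\cfrac{1}{\ddots-\cfrac1{e_r}}}$ (Hirzebruch–Jung continued fraction); every rational number $>1$ has a unique such expansion, so we identify the chain with its value. The Wahl chain of coprime integers $0<a<n$ is the expansion of $\frac{n^2}{na-1}$; a Wahl chain is the Wahl chain of some such pair. A Markov triple is a triple of positive integers with $a^2+b^2+c^2=3abc$. For coprime integers $0<q<m$ write $\frac mq=[x_1,\dots,x_r]$, $\frac m{m-q}=[y_1,\dots,y_s]$ and let $\frac{\Delta_0}{\Omega_0}=[5,x_1,\dots,x_r,2,y_s,\dots,y_1,5]$ in lowest terms; the cyclic quotient singularity $\frac1{\Delta_0}(1,\Omega_0)$ is called the Markov c.q.s. of $(m,q)$. An extremal P-resolution of a cyclic quotient singularity $\frac1\Delta(1,\Omega)$ is a (toric) partial resolution $W^+$ whose exceptional locus is one smooth rational curve $\Gamma$, such that the two torus-fixed points on $\Gamma$ are Wahl singularities $\frac1{n_0^2}(1,n_0a_0-1)$, $\frac1{n_1^2}(1,n_1a_1-1)$ with $0<a_i<n_i$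 coprime (or smooth points, where one sets $(n_0,a_0)=(1,0)$, respectively $(n_1,a_1)=(1,1)$), and $K_{W^+}\cdot\Gamma>0$. In toric terms, it is the subdivision of the cone in $\mathbb R^2$ (lattice $\mathbb Z^2$) generated by $(0,1)$ and $(\Delta,-\Omega)$ by the ray of $\Gamma$, the two singularities being read in the order from $(0,1)$ to $(\Delta,-\Omega)$. Its middle curve is the strict transform of $\Gamma$ in the minimal resolution of $W^+$; if this is a $(-c)$-curve, then $\delta=(c-1)n_0n_1+n_1a_0-n_0a_1$. Theorem. Let $m$ be a non-negative integer. (1) There are an integer $0<q<m$ coprime to $m$ and Wahl chains $W_0,W_1$ with $$[5,x_1,\dots,x_r,2,y_s,\dots,y_1,5]=[W_0,2,W_1]\qquad(*)$$ if and only if there is a Markov triple $(a,b,c)$ with $a,b<c=m$. There are $q,W_0,W_1$ as in $(*)$ with, in addition, $W_0\ne[5,2]$ and $W_1\ne[2,5]$ if and only if there is a Markov triple $(a,b,c)$ with $1<a,b<c=m$. (2) Let $0<q<m$ be coprime. (a) $(*)$ holds for some Wahl chains $W_0,W_1$ if and only if there is a Markov triple $(a,b,c)$ with $a,b<c=m$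 and $aq\equiv 3b\pmod m$. It holds for some Wahl chains $W_0\neq[5,2]$, $W_1\ne[2,5]$ if and only if there is such a triple with $1<a,b$. (b) $(*)$ holds for some Wahl chains $W_0,W_1$ if and only if the Markov c.q.s. $\frac1{\Delta_0}(1,\Omega_0)$ admits an extremal P-resolution with a middle $(-2)$-curve and $\delta=3m$. (c) More precisely, if $W_i$ is the Wahl chain of $0<a_i<n_i$ ($i=0,1$), then $(*)$ holds for $W_0,W_1$ if and only if $\frac1{\Delta_0}(1,\Omega_0)$ admits an extremal P-resolution with Wahl singularities $\frac1{n_0^2}(1,n_0a_0-1)$, $\frac1{n_1^2}(1,n_1a_1-1)$ (in this order), a middle $(-2)$-curve and $\delta=3m$. -/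

import Mathlib

/-- A Markov triple: a positive integer solution of `x² + y² + z² = 3xyz`. -/
def IsMarkovTriple (a b c : ℕ) : Prop :=
  0 < a ∧ 0 < b ∧ 0 < c ∧ a ^ 2 + b ^ 2 + c ^ 2 = 3 * a * b * c

/-! ### Hirzebruch-Jung continued fractions and Wahl chains -/

/-- The value `e₁ - 1/(e₂ - 1/(⋯ - 1/e_r))`. The convention `0⁻¹ = 0` makes `hjValue [e] = e`. -/
def hjValue : List ℤ → ℚ
  | [] => 0
  | e :: l => e - (hjValue l)⁻¹

/-- `l = [e₁, …, e_r]`, with `r ≥ 1` and all `e_i ≥ 2`, is the Hirzebruch-Jung continued fraction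
of the rational number `t` (such a list is unique, and exists exactly when `t > 1`). -/
def IsHJChain (l : List ℤ) (t : ℚ) : Prop :=
  l ≠ [] ∧ (∀ e ∈ l, 2 ≤ e) ∧ hjValue l = t

/-- `W` is the Wahl chain of the coprime integers `0 < a < n`, that is, the Hirzebruch-Jung
continued fraction of `n² / (na - 1)`. -/
def IsWahlChainOf (n a : ℤ) (W : List ℤ) : Prop :=
  0 < a ∧ a < n ∧ IsCoprime n a ∧ IsHJChain W ((n : ℚ) ^ 2 / (n * a - 1))

/-- `W` is a (non-empty) Wahl chain. -/
def IsWahlChain (W : List ℤ) : Prop := ∃ n a : ℤ, IsWahlChainOf n a W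

/-- `0 < q < m` are coprime, `m / q = [x₁, …, x_r]` and `m / (m - q) = [y₁, …, y_s]`. -/
def IsDualHJPair (m q : ℕ) (x y : List ℤ) : Prop :=
  0 < q ∧ q < m ∧ Nat.Coprime m q ∧
    IsHJChain x ((m : ℚ) / q) ∧ IsHJChain y ((m : ℚ) / ((m : ℚ) - q))

/-- The chain `[5, x₁, …, x_r, 2, y_s, …, y₁, 5]`. -/
def markovChain (x y : List ℤ) : List ℤ := [5] ++ x ++ [2] ++ y.reverse ++ [5]

/-! ### Cyclic quotient singularities and extremal P-resolutions, as toric surfaces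

The lattice is `ℤ²`. A cyclic quotient singularity is the affine toric surface of a strictly convex
two-dimensional cone; a partial resolution whose exceptional locus is one curve `Γ` (necessarily a
smooth rational curve) is the subdivision of the cone by one interior ray, which corresponds to `Γ`.
-/

/-- The determinant of two lattice vectors, with the sign for which a pair `u, w` listed clockwise
has `latticeDet u w > 0`. -/
def latticeDet (u w : ℤ × ℤ) : ℤ := w.1 * u.2 - w.2 * u.1

/-- The cone with primitive generators `u, w` (listed clockwise) is a cyclic quotient singularity
`1/n (1, q)`, read from `u` to `w`: its multiplicity is `n` and `(w + q u) / n` is a lattice vector.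
The model case is `u = (0, 1)`, `w = (n, -q)`. If `n / q = [e₁, …, e_r]`, then the rays
`u = u₀, u₁, …, u_{r+1} = w` of its minimal resolution satisfy
`u₁ = (w + q u) / n` and `u_{i-1} + u_{i+1} = e_i u_i`.
For `n = 1` it is a smooth point. -/
def IsCyclicQuotientCone (u w : ℤ × ℤ) (n q : ℤ) : Prop :=
  IsCoprime u.1 u.2 ∧ IsCoprime w.1 w.2 ∧ 0 < n ∧ latticeDet u w = n ∧
    ∃ z : ℤ × ℤ, w + q • u = n • z

/-- `z` generates the ray adjacent to the ray of `v` in the minimal resolution of the cone of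
multiplicity `n` with primitive generators `v` and `u` (so `z = u` if `n = 1`). -/
def IsAdjacentRay (v u : ℤ × ℤ) (n : ℤ) (z : ℤ × ℤ) : Prop :=
  ∃ s : ℤ, 0 ≤ s ∧ s < n ∧ u + s • v = n • z

/-- The self-intersection `Γ²` of the complete torus-invariant curve `Γ` of the interior ray `v`, in
the toric surface with rays `u, v, w`. It is determined by `D_u · Γ = 1 / det(u, v)`,
`D_w · Γ = 1 / det(v, w)` and the linear relation `det(v,w) u + det(u,v) w = det(u,w) v`. -/
def toricSelfInt (u v w : ℤ × ℤ) : ℚ :=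
  -(latticeDet u w : ℚ) / (latticeDet u v * latticeDet v w)

/-- The intersection number `K · Γ`, where `K = -(D_u + D_v + D_w)` and `Γ = D_v`. -/
def toricCanonicalDegree (u v w : ℤ × ℤ) : ℚ :=
  -(1 / (latticeDet u v : ℚ) + toricSelfInt u v w + 1 / (latticeDet v w : ℚ))

/-- An extremal P-resolution `W⁺` of the cyclic quotient singularity `1/Δ (1, Ω)` (the cone with
generators `(0, 1)` and `(Δ, -Ω)`): a partial resolution with exceptional curve `Γ ≅ ℙ¹` whose two
torus-fixed points are Wahl singularities `1/nᵢ² (1, nᵢ aᵢ - 1)` (or smooth, with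
`(n₀, a₀) = (1, 0)`, resp. `(n₁, a₁) = (1, 1)`), and with `K · Γ > 0`. -/
structure ExtremalPResolution (Δ Ω : ℤ) where
  /-- primitive generator of the ray of `Γ` -/
  v : ℤ × ℤ
  n₀ : ℤ
  a₀ : ℤ
  n₁ : ℤ
  a₁ : ℤ
  /-- minus the self-intersection of the strict transform of `Γ` in the minimal resolution -/
  c : ℤ
  base : IsCyclicQuotientCone (0, 1) (Δ, -Ω) Δ Ω
  pair₀ : (0 < a₀ ∧ a₀ < n₀ ∧ IsCoprime n₀ a₀) ∨ (n₀ = 1 ∧ a₀ = 0)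
  pair₁ : (0 < a₁ ∧ a₁ < n₁ ∧ IsCoprime n₁ a₁) ∨ (n₁ = 1 ∧ a₁ = 1)
  wahl₀ : IsCyclicQuotientCone (0, 1) v (n₀ ^ 2) (n₀ * a₀ - 1)
  wahl₁ : IsCyclicQuotientCone v (Δ, -Ω) (n₁ ^ 2) (n₁ * a₁ - 1)
  middle : ∃ z₀ z₁ : ℤ × ℤ, IsAdjacentRay v (0, 1) (n₀ ^ 2) z₀ ∧
    IsAdjacentRay v (Δ, -Ω) (n₁ ^ 2) z₁ ∧ z₀ + z₁ = c • v
  K_pos : 0 < toricCanonicalDegree (0, 1) v (Δ, -Ω)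

/-- The invariant `δ = (c - 1) n₀ n₁ + n₁ a₀ - n₀ a₁`, which equals `n₀ n₁ (K · Γ)`. -/
def ExtremalPResolution.delta {Δ Ω : ℤ} (R : ExtremalPResolution Δ Ω) : ℤ :=
  (R.c - 1) * R.n₀ * R.n₁ + R.n₁ * R.a₀ - R.n₀ * R.a₁

/-- The extremal P-resolutions of the Markov cyclic quotient singularity `1/Δ₀ (1, Ω₀)`, where
`Δ₀ / Ω₀ = [5, x₁, …, x_r, 2, y_s, …, y₁, 5]` in lowest terms. -/
abbrev MarkovPResolution (x y : List ℤ) : Type :=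
  ExtremalPResolution (hjValue (markovChain x y)).num (hjValue (markovChain x y)).den

/-! A chain with entries at least 2 is determined by its value, hence by the first column of its
matrix in SL₂(ℤ) (`eq_of_hjMatrix_column_eq`). The matrix of a Wahl chain is polynomial in `(n, a)`;
by duality of `x` and `y`, that of the Markov chain is polynomial in `(m, q)`. So a splitting is a
system of polynomial equations.

Put `a = n₁ - a₁`, `b = a₀`, `δ = n₀ a + n₁ b`. The off-diagonal entries give `δ² = 9 m²`, so `δ =
3m`; the lower right entry then becomes the Markov equation for `(a, b, m)`, and the other entries
give `n₀`, `n₁` linearly in `a`, `b` (`markovChain_eq_iff`). Modulo `m` the formula for `n₁` reads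
`a q ≡ 3 b`. The inequalities `a₀ < n₀` and `0 < a₁` force `m` to be the largest member. Conversely,
a triple with this congruence makes both formulas integral, and the pairs obtained are coprime
because Markov numbers are pairwise coprime and prime to 3.

On the toric side, a middle `(-2)`-curve fixes `Δ`, and fixes `Ω` modulo `Δ`, by the same
polynomials (`eq_of_c_eq_two`). With `δ = 3m`, a smooth point on `Γ` would make `Ω` larger than the
`4m² + mq - 1` of the Markov singularity. -/

/-! ### Continued fractions and products of elementary matrices -/

/-- The product of the matrices `!![e, -1; 1, 0]` over the entries `e` of a chain. -/
def hjMatrix (l : List ℤ) : Matrix (Fin 2) (Fin 2) ℤ :=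
  (l.map fun e => !![e, -1; 1, 0]).prod

theorem hjMatrix_nil : hjMatrix [] = 1 := rfl

theorem hjMatrix_cons (e : ℤ) (l : List ℤ) :
    hjMatrix (e :: l) = !![e, -1; 1, 0] * hjMatrix l := by
  simp [hjMatrix]

theorem hjMatrix_singleton (e : ℤ) : hjMatrix [e] = !![e, -1; 1, 0] := by
  simp [hjMatrix]

theorem hjMatrix_append (l l' : List ℤ) : hjMatrix (l ++ l') = hjMatrix l * hjMatrix l' := by
  simp [hjMatrix]

theorem hjMatrix_cons_zero_zero (e : ℤ) (l : List ℤ) :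
    hjMatrix (e :: l) 0 0 = e * hjMatrix l 0 0 - hjMatrix l 1 0 := by
  simp [hjMatrix_cons, Matrix.mul_apply, Fin.sum_univ_two]; ring

theorem hjMatrix_cons_one_zero (e : ℤ) (l : List ℤ) :
    hjMatrix (e :: l) 1 0 = hjMatrix l 0 0 := by
  simp [hjMatrix_cons, Matrix.mul_apply, Fin.sum_univ_two]

theorem hjMatrix_det (l : List ℤ) :
    hjMatrix l 0 0 * hjMatrix l 1 1 - hjMatrix l 0 1 * hjMatrix l 1 0 = 1 := by
  rw [← Matrix.det_fin_two]
  induction l with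
  | nil => simp [hjMatrix_nil]
  | cons e l ih => rw [hjMatrix_cons, Matrix.det_mul, ih]; simp [Matrix.det_fin_two]

/-- Conjugation by `diag(1, -1)` transposes each elementary factor, and transposition reverses
products. -/
theorem hjMatrix_reverse (l : List ℤ) :
    hjMatrix l.reverse =
      !![hjMatrix l 0 0, -hjMatrix l 1 0; -hjMatrix l 0 1, hjMatrix l 1 1] := by
  induction l with
  | nil => ext i j; fin_cases i <;> fin_cases j <;> simp [hjMatrix_nil]
  | cons e l ih =>
    rw [List.reverse_cons, hjMatrix_append, ih, hjMatrix_singleton, hjMatrix_cons]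
    ext i j
    fin_cases i <;> fin_cases j <;> simp [Matrix.mul_apply, Fin.sum_univ_two] <;> ring

theorem hjMatrix_column {l : List ℤ} (hl : ∀ e ∈ l, 2 ≤ e) :
    0 ≤ hjMatrix l 1 0 ∧ hjMatrix l 1 0 < hjMatrix l 0 0 := by
  induction l with
  | nil => simp [hjMatrix_nil]
  | cons e l ih =>
    obtain ⟨h0, h1⟩ := ih fun e he => hl e (List.mem_cons_of_mem _ he)
    have he : 2 ≤ e := hl e List.mem_cons_self
    rw [hjMatrix_cons_zero_zero, hjMatrix_cons_one_zero]
    constructor <;> nlinarith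

theorem hjMatrix_one_zero_pos {l : List ℤ} (hne : l ≠ []) (hl : ∀ e ∈ l, 2 ≤ e) :
    0 < hjMatrix l 1 0 := by
  cases l with
  | nil => exact absurd rfl hne
  | cons e l =>
    have := hjMatrix_column fun e he => hl e (List.mem_cons_of_mem _ he)
    rw [hjMatrix_cons_one_zero]
    omega

theorem hjMatrix_row {l : List ℤ} (hl : ∀ e ∈ l, 2 ≤ e) :
    hjMatrix l 0 1 ≤ 0 ∧ -hjMatrix l 0 0 < hjMatrix l 0 1 := by
  have h := hjMatrix_column (l := l.reverse) fun e he => hl e (List.mem_reverse.1 he)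
  simp only [hjMatrix_reverse, Matrix.of_apply, Matrix.cons_val', Matrix.cons_val_zero,
    Matrix.cons_val_one, Matrix.cons_val_fin_one] at h
  omega

theorem hjValue_eq_div {l : List ℤ} (hl : ∀ e ∈ l, 2 ≤ e) :
    hjValue l = (hjMatrix l 0 0 : ℚ) / hjMatrix l 1 0 := by
  induction l with
  | nil => simp [hjValue, hjMatrix_nil]
  | cons e l ih =>
    have hl' : ∀ e ∈ l, 2 ≤ e := fun e he => hl e (List.mem_cons_of_mem _ he)
    have h := hjMatrix_column hl'
    have h0 : (hjMatrix l 0 0 : ℚ) ≠ 0 := by exact_mod_cast (by omega : hjMatrix l 0 0 ≠ 0)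
    rw [hjValue, ih hl', hjMatrix_cons_zero_zero, hjMatrix_cons_one_zero, inv_div]
    push_cast
    field_simp

/-- This makes the leading entry the ceiling of the value, hence the expansion unique; the empty
tail contributes 0. -/
theorem inv_hjValue_mem {l : List ℤ} (hl : ∀ e ∈ l, 2 ≤ e) :
    0 ≤ (hjValue l)⁻¹ ∧ (hjValue l)⁻¹ < 1 := by
  have h := hjMatrix_column hl
  have h0 : (0 : ℚ) ≤ hjMatrix l 1 0 := by exact_mod_cast h.1
  have h1 : (hjMatrix l 1 0 : ℚ) < hjMatrix l 0 0 := by exact_mod_cast h.2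
  rw [hjValue_eq_div hl, inv_div]
  exact ⟨div_nonneg h0 (h0.trans h1.le), (div_lt_one (h0.trans_lt h1)).2 h1⟩

theorem hjValue_ne_zero {l : List ℤ} (hne : l ≠ []) (hl : ∀ e ∈ l, 2 ≤ e) : hjValue l ≠ 0 := by
  have h := hjMatrix_column hl
  have h1 := hjMatrix_one_zero_pos hne hl
  rw [hjValue_eq_div hl]
  exact div_ne_zero (by exact_mod_cast (by omega : hjMatrix l 0 0 ≠ 0))
    (by exact_mod_cast h1.ne')

/-- A rational number has at most one Hirzebruch-Jung expansion. -/
theorem hjValue_injOn {l l' : List ℤ} (hl : ∀ e ∈ l, 2 ≤ e) (hl' : ∀ e ∈ l', 2 ≤ e)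
    (h : hjValue l = hjValue l') : l = l' := by
  induction l generalizing l' with
  | nil =>
    by_contra hne
    exact hjValue_ne_zero (Ne.symm hne) hl' (by rw [← h, hjValue])
  | cons e l ih =>
    cases l' with
    | nil => exact absurd (h.trans (by rw [hjValue])) (hjValue_ne_zero (by simp) hl)
    | cons e' l' =>
      have hm : ∀ e ∈ l, 2 ≤ e := fun e he => hl e (List.mem_cons_of_mem _ he)
      have hm' : ∀ e ∈ l', 2 ≤ e := fun e he => hl' e (List.mem_cons_of_mem _ he)
      have b := inv_hjValue_mem hm
      have b' := inv_hjValue_mem hm'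
      rw [hjValue, hjValue] at h
      have h1 : e < e' + 1 := by
        have : (e : ℚ) < e' + 1 := by linarith
        exact_mod_cast this
      have h2 : e' < e + 1 := by
        have : (e' : ℚ) < e + 1 := by linarith
        exact_mod_cast this
      obtain rfl : e = e' := by omega
      rw [ih hm hm' (inv_injective (by linarith))]

theorem IsHJChain.unique {l l' : List ℤ} {t : ℚ} (h : IsHJChain l t) (h' : IsHJChain l' t) :
    l = l' :=
  hjValue_injOn h.2.1 h'.2.1 (h.2.2.trans h'.2.2.symm)

theorem exists_isHJChain_of_lt (q : ℕ) (hq : 0 < q) (p : ℕ) (hp : q < p) :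
    ∃ l, IsHJChain l ((p : ℚ) / q) := by
  induction q using Nat.strong_induction_on generalizing p with
  | _ q ih =>
    have hq' : (q : ℚ) ≠ 0 := by positivity
    by_cases hd : q ∣ p
    · obtain ⟨k, rfl⟩ := hd
      have hk : 2 ≤ k := by by_contra hk; interval_cases k <;> omega
      refine ⟨[(k : ℤ)], by simp, by simpa using by exact_mod_cast hk, ?_⟩
      simp only [hjValue, inv_zero, sub_zero]
      push_cast
      field_simp
    · have hr : 0 < p % q := Nat.pos_of_ne_zero fun h => hd (Nat.dvd_of_mod_eq_zero h)
      have hlt : p % q < q := Nat.mod_lt _ hq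
      have hdiv := Nat.div_add_mod p q
      have h1 : 1 ≤ p / q := (Nat.one_le_div_iff hq).2 hp.le
      -- Division rounded up, with `k = ⌊p/q⌋` and remainder `r`: `p/q = (k + 1) - (q - r)/q`, so
      -- the tail expands `q/(q - r)`.
      obtain ⟨l, hne, hl, hv⟩ := ih (q - p % q) (by omega) (by omega) q (by omega)
      refine ⟨((p / q + 1 : ℕ) : ℤ) :: l, by simp, ?_, ?_⟩
      · intro e he
        rcases List.mem_cons.1 he with rfl | he
        · push_cast; exact_mod_cast (by omega : 2 ≤ p / q + 1)
        · exact hl e he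
      · have hdq : (p : ℚ) = q * (p / q : ℕ) + (p % q : ℕ) := by exact_mod_cast hdiv.symm
        rw [hjValue, hv, inv_div, Nat.cast_sub hlt.le]
        generalize p / q = k at *
        rw [hdq]
        push_cast
        field_simp
        ring

theorem exists_isHJChain {p q : ℤ} (hq : 0 < q) (hp : q < p) :
    ∃ l, IsHJChain l ((p : ℚ) / q) := by
  lift q to ℕ using hq.le
  lift p to ℕ using (hq.trans hp).le
  exact exists_isHJChain_of_lt q (by exact_mod_cast hq) p (by exact_mod_cast hp)

theorem eq_of_div_eq_div_of_isCoprime {p q p' q' : ℤ} (hq : 0 < q) (hq' : 0 < q')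
    (h : IsCoprime p q) (h' : IsCoprime p' q') (he : (p : ℚ) / q = p' / q') :
    p = p' ∧ q = q' := by
  have := (Rat.div_int_inj hq hq' (Int.isCoprime_iff_nat_coprime.1 h)
    (Int.isCoprime_iff_nat_coprime.1 h') he)
  exact this

theorem hjMatrix_isCoprime (l : List ℤ) : IsCoprime (hjMatrix l 0 0) (hjMatrix l 1 0) :=
  ⟨hjMatrix l 1 1, -hjMatrix l 0 1, by linarith [hjMatrix_det l]⟩

/-- The matrix of the chain of `p / q` is `!![p, b; q, d]` with determinant one, `-p < b ≤ 0`. -/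
theorem IsHJChain.hjMatrix_eq {l : List ℤ} {p q b d : ℤ} (h : IsHJChain l ((p : ℚ) / q))
    (hq : 0 < q) (hdet : p * d - b * q = 1) (hb : b ≤ 0) (hb' : -p < b) :
    hjMatrix l = !![p, b; q, d] := by
  obtain ⟨hne, hl, hv⟩ := h
  have hpos := hjMatrix_one_zero_pos hne hl
  obtain ⟨h00, h10⟩ := eq_of_div_eq_div_of_isCoprime hpos hq (hjMatrix_isCoprime l)
    ⟨d, -b, by linarith⟩ ((hjValue_eq_div hl).symm.trans hv)
  have hd := hjMatrix_det l
  have hr := hjMatrix_row hl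
  have hc := hjMatrix_column hl
  rw [h00, h10] at hd
  rw [h00] at hr
  have hcop : IsCoprime p q := ⟨d, -b, by linarith⟩
  -- Determinant one fixes the upper right entry modulo `p`, and the range `(-p, 0]` then fixes it
  -- outright.
  have hdvd : p ∣ hjMatrix l 0 1 - b :=
    hcop.dvd_of_dvd_mul_right ⟨hjMatrix l 1 1 - d, by linarith⟩
  have h01 : hjMatrix l 0 1 = b := by
    have := Int.eq_zero_of_abs_lt_dvd hdvd (by rw [abs_lt]; constructor <;> linarith)
    linarith
  have h11 : hjMatrix l 1 1 = d := by
    rw [h01] at hd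
    exact mul_left_cancel₀ (by omega : p ≠ 0) (by linarith)
  rw [Matrix.eta_fin_two (hjMatrix l), h00, h10, h01, h11]

/-! ### The matrices of Wahl chains and of Markov chains -/

/-- The upper right entry is `-(n(n - a) - 1)`, since `n(n - a) - 1` inverts `na - 1` modulo `n²`.
-/
theorem IsWahlChainOf.hjMatrix_eq {n a : ℤ} {W : List ℤ} (h : IsWahlChainOf n a W) :
    hjMatrix W = !![n ^ 2, n * a + 1 - n ^ 2; n * a - 1, a ^ 2 - n * a + 1] := by
  obtain ⟨ha, han, -, hW⟩ := h
  refine IsHJChain.hjMatrix_eq (by push_cast; exact hW) ?_ (by ring) ?_ ?_ <;> nlinarith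

theorem IsHJChain.column_eq {l : List ℤ} {p q : ℤ} (h : IsHJChain l ((p : ℚ) / q)) (hq : 0 < q)
    (hpq : IsCoprime p q) : hjMatrix l 0 0 = p ∧ hjMatrix l 1 0 = q :=
  eq_of_div_eq_div_of_isCoprime (hjMatrix_one_zero_pos h.1 h.2.1) hq (hjMatrix_isCoprime l) hpq
    ((hjValue_eq_div h.2.1).symm.trans h.2.2)

/-- If `x` has matrix `!![m, b; q, d]`, that of `y` is also expressed through `m, q, b, d`; in the
product, `b` and `d` enter only through the determinant `md - bq = 1`. -/
theorem IsDualHJPair.hjMatrix_eq {m q : ℕ} {x y : List ℤ} (h : IsDualHJPair m q x y) :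
    hjMatrix (markovChain x y) =
      !![20 * (m : ℤ) ^ 2 + m * q - q ^ 2 - 9, m * q - 5 * (m : ℤ) ^ 2 + 1;
        4 * (m : ℤ) ^ 2 + m * q - 1, -(m : ℤ) ^ 2] := by
  obtain ⟨hq, hqm, hcop, hx, hy⟩ := h
  have hq' : (0 : ℤ) < q := by exact_mod_cast hq
  have hqm' : (q : ℤ) < m := by exact_mod_cast hqm
  obtain ⟨h00, h10⟩ := IsHJChain.column_eq (l := x) (p := m) (q := q) (by push_cast; exact hx) hq'
    (Nat.isCoprime_iff_coprime.2 hcop)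
  have hr := hjMatrix_row hx.2.1
  have hd := hjMatrix_det x
  have hX := Matrix.eta_fin_two (hjMatrix x)
  generalize hjMatrix x 0 1 = b at *
  generalize hjMatrix x 1 1 = d at *
  rw [h00, h10] at hX
  rw [h00] at hr
  rw [h00, h10] at hd
  -- Needed for the strict bound `-m < -(m + b)` on the upper right entry for `y`.
  have hb : b ≠ 0 := by
    rintro rfl
    have : (m : ℤ) ∣ 1 := ⟨d, by linarith⟩
    have := Int.le_of_dvd one_pos this
    omega
  have hY := IsHJChain.hjMatrix_eq (p := m) (q := m - q) (b := -(m + b)) (d := d - m + q - b)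
    (by push_cast; exact hy) (by omega) (by linear_combination hd) (by omega) (by omega)
  rw [markovChain, hjMatrix_append, hjMatrix_append, hjMatrix_append, hjMatrix_append,
    hjMatrix_reverse, hY, hX, hjMatrix_singleton, hjMatrix_singleton]
  ext i j
  fin_cases i <;> fin_cases j <;> simp [Matrix.mul_apply, Fin.sum_univ_two]
  · linear_combination (-9 : ℤ) * hd
  · linear_combination hd
  · linear_combination (-1 : ℤ) * hd
  · ring

/-- The recurring factor `n₀ (n₁ - a₁) + n₁ a₀` is `δ` for a middle `(-2)`-curve. -/
theorem IsWahlChainOf.hjMatrix_append_two_append {n₀ a₀ n₁ a₁ : ℤ} {W₀ W₁ : List ℤ}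
    (h₀ : IsWahlChainOf n₀ a₀ W₀) (h₁ : IsWahlChainOf n₁ a₁ W₁) :
    hjMatrix (W₀ ++ [2] ++ W₁) =
      !![n₀ ^ 2 + n₁ ^ 2 + (n₀ * (n₁ - a₁) + n₁ * a₀) * (n₀ * n₁),
        1 + n₀ * a₀ - n₁ * (n₁ - a₁) - (n₀ * (n₁ - a₁) + n₁ * a₀) * (n₀ * (n₁ - a₁));
        (n₀ * (n₁ - a₁) + n₁ * a₀) * (a₀ * n₁) + n₀ * a₀ - n₁ * (n₁ - a₁) - 1,
        a₀ ^ 2 + (n₁ - a₁) ^ 2 - (n₀ * (n₁ - a₁) + n₁ * a₀) * (a₀ * (n₁ - a₁))] := by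
  rw [hjMatrix_append, hjMatrix_append, h₀.hjMatrix_eq, h₁.hjMatrix_eq, hjMatrix_singleton]
  ext i j
  fin_cases i <;> fin_cases j <;> simp [Matrix.mul_apply, Fin.sum_univ_two] <;> ring

theorem IsWahlChainOf.two_le {n a : ℤ} {W : List ℤ} (h : IsWahlChainOf n a W) :
    ∀ e ∈ W, 2 ≤ e := h.2.2.2.2.1

theorem IsWahlChainOf.two_le_append {n₀ a₀ n₁ a₁ : ℤ} {W₀ W₁ : List ℤ}
    (h₀ : IsWahlChainOf n₀ a₀ W₀) (h₁ : IsWahlChainOf n₁ a₁ W₁) :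
    ∀ e ∈ W₀ ++ [2] ++ W₁, 2 ≤ e := by
  intro e he
  simp only [List.mem_append, List.mem_singleton] at he
  rcases he with (he | rfl) | he
  exacts [h₀.two_le e he, le_rfl, h₁.two_le e he]

theorem IsDualHJPair.two_le {m q : ℕ} {x y : List ℤ} (h : IsDualHJPair m q x y) :
    ∀ e ∈ markovChain x y, 2 ≤ e := by
  intro e he
  simp only [markovChain, List.mem_append, List.mem_singleton, List.mem_reverse] at he
  rcases he with (((rfl | he) | rfl) | he) | rfl
  exacts [by norm_num, h.2.2.2.1.2.1 e he, le_rfl, h.2.2.2.2.2.1 e he, by norm_num]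

theorem markovChain_ne_nil (x y : List ℤ) : markovChain x y ≠ [] := by simp [markovChain]

/-- Two chains with entries at least two are equal when the first columns of their matrices are. -/
theorem eq_of_hjMatrix_column_eq {l l' : List ℤ} (hl : ∀ e ∈ l, 2 ≤ e) (hl' : ∀ e ∈ l', 2 ≤ e)
    (h0 : hjMatrix l 0 0 = hjMatrix l' 0 0) (h1 : hjMatrix l 1 0 = hjMatrix l' 1 0) : l = l' :=
  hjValue_injOn hl hl' (by rw [hjValue_eq_div hl, hjValue_eq_div hl', h0, h1])

theorem markovChain_eq_iff_column {m q : ℕ} {x y W₀ W₁ : List ℤ} {n₀ a₀ n₁ a₁ : ℤ}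
    (h : IsDualHJPair m q x y) (h₀ : IsWahlChainOf n₀ a₀ W₀) (h₁ : IsWahlChainOf n₁ a₁ W₁) :
    markovChain x y = W₀ ++ [2] ++ W₁ ↔
      20 * (m : ℤ) ^ 2 + m * q - q ^ 2 - 9 =
          n₀ ^ 2 + n₁ ^ 2 + (n₀ * (n₁ - a₁) + n₁ * a₀) * (n₀ * n₁) ∧
        4 * (m : ℤ) ^ 2 + m * q - 1 =
          (n₀ * (n₁ - a₁) + n₁ * a₀) * (a₀ * n₁) + n₀ * a₀ - n₁ * (n₁ - a₁) - 1 := by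
  have hM := h.hjMatrix_eq
  have hW := h₀.hjMatrix_append_two_append h₁
  constructor
  · intro he
    rw [he, hW] at hM
    have e0 := congrFun (congrFun hM 0) 0
    have e1 := congrFun (congrFun hM 1) 0
    simp at e0 e1
    exact ⟨e0.symm, by linarith⟩
  · rintro ⟨e0, e1⟩
    refine eq_of_hjMatrix_column_eq h.two_le (h₀.two_le_append h₁) ?_ ?_ <;> rw [hM, hW]
    exacts [e0, e1]

/-- The Markov chain of `(m, q)` splits as `[W₀, 2, W₁]` exactly when `(n₁ - a₁, a₀, m)` solves the
Markov equation and `n₀`, `n₁` are determined by it and `q`. -/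
theorem markovChain_eq_iff {m q : ℕ} {x y W₀ W₁ : List ℤ} {n₀ a₀ n₁ a₁ : ℤ}
    (h : IsDualHJPair m q x y) (h₀ : IsWahlChainOf n₀ a₀ W₀) (h₁ : IsWahlChainOf n₁ a₁ W₁) :
    markovChain x y = W₀ ++ [2] ++ W₁ ↔
      (n₁ - a₁) ^ 2 + a₀ ^ 2 + (m : ℤ) ^ 2 = 3 * (n₁ - a₁) * a₀ * m ∧
        m * n₀ = (5 * (m : ℤ) - q) * a₀ - 3 * (n₁ - a₁) ∧
        m * n₁ = (4 * (m : ℤ) + q) * (n₁ - a₁) - 3 * a₀ := by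
  have hm : (0 : ℤ) < m := by exact_mod_cast h.1.trans h.2.1
  have ha₀ : 0 < a₀ := h₀.1
  have hn₀ : 0 < n₀ := ha₀.trans h₀.2.1
  have hn₁ : 0 < n₁ := h₁.1.trans h₁.2.1
  have ha₁ : 0 < n₁ - a₁ := sub_pos.2 h₁.2.1
  constructor
  · intro he
    have hM := h.hjMatrix_eq
    rw [he, h₀.hjMatrix_append_two_append h₁] at hM
    have e01 := congrFun (congrFun hM 0) 1
    have e10 := congrFun (congrFun hM 1) 0
    have e11 := congrFun (congrFun hM 1) 1
    simp at e01 e10 e11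
    generalize n₁ - a₁ = a at *
    have hp : 0 < n₀ * a + n₁ * a₀ := by positivity
    -- The difference of the off-diagonal entries is `δ² - 2` on one side and `9m² - 2` on the
    -- other.
    have hδ : n₀ * a + n₁ * a₀ = 3 * m := by
      have : (n₀ * a + n₁ * a₀) ^ 2 = (3 * (m : ℤ)) ^ 2 := by linear_combination e10 - e01
      exact (pow_left_inj₀ hp.le (by positivity) two_ne_zero).1 this
    rw [hδ] at e01 e10 e11
    refine ⟨by linear_combination e11, mul_left_cancel₀ hm.ne' ?_, mul_left_cancel₀ hm.ne' ?_⟩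
    · linear_combination n₀ * e11 - a₀ * e01 - a * hδ
    · linear_combination a * e10 + n₁ * e11 - a₀ * hδ
  · rintro ⟨hmar, k₀, k₁⟩
    rw [markovChain_eq_iff_column h h₀ h₁]
    generalize n₁ - a₁ = a at *
    have hδ : n₀ * a + n₁ * a₀ = 3 * m := by
      refine mul_left_cancel₀ hm.ne' ?_
      linear_combination a * k₀ + a₀ * k₁ - 3 * hmar
    rw [hδ]
    constructor
    · refine mul_left_cancel₀ (pow_ne_zero 2 hm.ne') ?_
      linear_combination ((5 * (m : ℤ) - q) * (4 * m + q) - 9) * hmar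
        - (m * n₀ + ((5 * (m : ℤ) - q) * a₀ - 3 * a) + 3 * m * (m * n₁)) * k₀
        - (m * n₁ + ((4 * (m : ℤ) + q) * a - 3 * a₀)
          + 3 * m * ((5 * (m : ℤ) - q) * a₀ - 3 * a)) * k₁
    · refine mul_left_cancel₀ hm.ne' ?_
      linear_combination (4 * (m : ℤ) + q) * hmar - a₀ * k₀ - (3 * m * a₀ - a) * k₁

/-! ### Solutions of the Markov equation -/

/-- Vieta: `3ab - c` is the second root of `t² - 3abt + a² + b²`. The roots have positive product,
and the polynomial is negative at `max(a, b)`, so `c` is the larger one. -/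
theorem markov_mutation_lt {a b c : ℤ} (ha : 2 ≤ a) (hb : 2 ≤ b) (hac : a ≤ c) (hbc : b ≤ c)
    (h : a ^ 2 + b ^ 2 + c ^ 2 = 3 * a * b * c) :
    0 < 3 * a * b - c ∧ 3 * a * b - c < c := by
  have hc : 0 < c := by omega
  have hprod : (3 * a * b - c) * c = a ^ 2 + b ^ 2 := by linarith
  have hpos : 0 < 3 * a * b - c := by
    by_contra! hle
    nlinarith [mul_nonneg (neg_nonneg.2 hle) hc.le]
  refine ⟨hpos, ?_⟩
  by_contra! hle
  rcases le_total a b with hab | hab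
  · nlinarith [mul_nonneg (sub_nonneg.2 hbc) (sub_nonneg.2 (hbc.trans hle)),
      mul_nonneg (sub_nonneg.2 ha) (sq_nonneg b), mul_self_le_mul_self (by omega) hab]
  · nlinarith [mul_nonneg (sub_nonneg.2 hac) (sub_nonneg.2 (hac.trans hle)),
      mul_nonneg (sub_nonneg.2 hb) (sq_nonneg a), mul_self_le_mul_self (by omega) hab]

/-- Infinite descent: mutation keeps divisibility by `d` and lowers the sum, while `d ≥ 2` keeps all
entries at least 2, so it could always be repeated. `N` bounds the sum. -/
theorem markov_no_common_divisor {d : ℤ} (hd : 2 ≤ d) (N : ℕ) :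
    ∀ a b c : ℤ, 0 < a → 0 < b → 0 < c → a ^ 2 + b ^ 2 + c ^ 2 = 3 * a * b * c →
      a + b + c ≤ N → d ∣ a → d ∣ b → d ∣ c → False := by
  induction N with
  | zero => intro a b c ha hb hc _ hN; push_cast at hN; omega
  | succ N ih =>
    intro a b c ha hb hc h hN hda hdb hdc
    have ha2 := hd.trans (Int.le_of_dvd ha hda)
    have hb2 := hd.trans (Int.le_of_dvd hb hdb)
    have hc2 := hd.trans (Int.le_of_dvd hc hdc)
    push_cast at hN
    have key : ∀ x y z : ℤ, 2 ≤ x → 2 ≤ y → x ≤ z → y ≤ z → d ∣ x → d ∣ y → d ∣ z →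
        x ^ 2 + y ^ 2 + z ^ 2 = 3 * x * y * z → x + y + z ≤ N + 1 → False := by
      intro x y z hx hy hxz hyz dx dy dz hxyz hs
      obtain ⟨h0, h1⟩ := markov_mutation_lt hx hy hxz hyz hxyz
      exact ih x y (3 * x * y - z) (by omega) (by omega) h0 (by linear_combination hxyz) (by omega)
        dx dy (dvd_sub (dy.mul_left _) dz)
    rcases le_total a b with hab | hab <;> rcases le_total b c with hbc | hbc <;>
      rcases le_total a c with hac | hac
    · exact key a b c ha2 hb2 hac hbc hda hdb hdc h hN
    · exact key a b c ha2 hb2 (hab.trans hbc) hbc hda hdb hdc h hN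
    · exact key a c b ha2 hc2 hab hbc hda hdc hdb (by linarith) (by linarith)
    · exact key a c b ha2 hc2 hab hbc hda hdc hdb (by linarith) (by linarith)
    · exact key a b c ha2 hb2 hac hbc hda hdb hdc h hN
    · exact key b c a hb2 hc2 hab hac hdb hdc hda (by linarith) (by linarith)
    · exact key b c a hb2 hc2 hab (hbc.trans hab) hdb hdc hda (by linarith) (by linarith)
    · exact key b c a hb2 hc2 hab hac hdb hdc hda (by linarith) (by linarith)

theorem IsMarkovTriple.eq_int {a b c : ℕ} (h : IsMarkovTriple a b c) :
    (a : ℤ) ^ 2 + (b : ℤ) ^ 2 + (c : ℤ) ^ 2 = 3 * a * b * c := by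
  exact_mod_cast h.2.2.2

theorem IsMarkovTriple.rotate {a b c : ℕ} (h : IsMarkovTriple a b c) : IsMarkovTriple b c a :=
  ⟨h.2.1, h.2.2.1, h.1, by linarith [h.2.2.2]⟩

theorem IsMarkovTriple.isCoprime {a b c : ℕ} (h : IsMarkovTriple a b c) :
    IsCoprime (a : ℤ) b := by
  have heq := h.eq_int
  obtain ⟨ha, hb, hc, -⟩ := h
  rw [Nat.isCoprime_iff_coprime, Nat.coprime_iff_gcd_eq_one]
  by_contra hg
  have hg2 : (2 : ℤ) ≤ (a.gcd b : ℕ) := by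
    have := Nat.gcd_pos_of_pos_left b ha
    omega
  have hda : ((a.gcd b : ℕ) : ℤ) ∣ a := by exact_mod_cast Nat.gcd_dvd_left a b
  have hdb : ((a.gcd b : ℕ) : ℤ) ∣ b := by exact_mod_cast Nat.gcd_dvd_right a b
  have hdc : ((a.gcd b : ℕ) : ℤ) ∣ c := by
    rw [← Int.pow_dvd_pow_iff two_ne_zero]
    have : (c : ℤ) ^ 2 = 3 * c * (a * b) - (a ^ 2 + b ^ 2) := by linarith
    rw [this]
    refine dvd_sub ?_ (dvd_add (pow_dvd_pow_of_dvd hda 2) (pow_dvd_pow_of_dvd hdb 2))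
    rw [pow_two]
    exact (mul_dvd_mul hda hdb).mul_left _
  exact markov_no_common_divisor hg2 (a + b + c) a b c (by exact_mod_cast ha)
    (by exact_mod_cast hb) (by exact_mod_cast hc) heq (by push_cast; rfl) hda hdb hdc

/-- If 3 divides `a`, then `b² + c² ≡ 0` modulo 3; squares being 0 or 1, 3 also divides `b`, against
coprimality. -/
theorem IsMarkovTriple.isCoprime_three {a b c : ℕ} (h : IsMarkovTriple a b c) :
    IsCoprime (a : ℤ) 3 := by
  rw [isCoprime_comm, Prime.coprime_iff_not_dvd Int.prime_three]
  intro h3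
  have h3b : (3 : ℤ) ∣ b := by
    have heq := h.eq_int
    have ha2 : ((a : ℤ) ^ 2) % 3 = 0 := Int.emod_eq_zero_of_dvd (dvd_pow h3 two_ne_zero)
    have hs : (3 : ℤ) ∣ (a : ℤ) ^ 2 + b ^ 2 + c ^ 2 := ⟨a * b * c, by linarith⟩
    rcases (by omega : (b : ℤ) % 3 = 0 ∨ (b : ℤ) % 3 = 1 ∨ (b : ℤ) % 3 = 2) with h1 | h1 | h1
    · exact Int.dvd_of_emod_eq_zero h1
    all_goals
      exfalso
      have hb2 : ((b : ℤ) ^ 2) % 3 = 1 := by rw [pow_two, Int.mul_emod, h1]; rfl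
      rcases (by omega : (c : ℤ) % 3 = 0 ∨ (c : ℤ) % 3 = 1 ∨ (c : ℤ) % 3 = 2) with h2 | h2 | h2
      all_goals
        have hc2 : ((c : ℤ) ^ 2) % 3 = 0 ∨ ((c : ℤ) ^ 2) % 3 = 1 := by
          rw [pow_two, Int.mul_emod, h2]; simp
        omega
  have := h.isCoprime.isUnit_of_dvd' h3 h3b
  exact absurd this (by decide)

/-- The largest member of a solution of the Markov equation is large. -/
theorem markov_largest_bound {a b m : ℤ} (ha : 0 < a) (hm : 2 ≤ m) (hab : a ≤ b) (hmb : m ≤ b)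
    (h : a ^ 2 + b ^ 2 + m ^ 2 = 3 * a * b * m) : 4 * (m * a) ≤ 3 * b := by
  rcases le_total a m with ham | ham
  · have hf : (b - m) * (b + m - 3 * a * m) = m ^ 2 * (3 * a - 3) + (m ^ 2 - a ^ 2) := by
      linear_combination h
    have hf0 : 0 < m ^ 2 * (3 * a - 3) + (m ^ 2 - a ^ 2) := by
      rcases (by omega : a = 1 ∨ 2 ≤ a) with rfl | ha2
      · nlinarith
      · nlinarith [mul_pos (by omega : 0 < m) (by omega : 0 < m)]
    have : 0 < b + m - 3 * a * m := pos_of_mul_pos_right (hf ▸ hf0) (by omega)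
    nlinarith
  · have hf : (b - a) * (b + a - 3 * a * m) = a ^ 2 * (3 * m - 3) + (a ^ 2 - m ^ 2) := by
      linear_combination h
    have hf0 : 0 < a ^ 2 * (3 * m - 3) + (a ^ 2 - m ^ 2) := by
      nlinarith [mul_pos ha ha]
    have : 0 < b + a - 3 * a * m := pos_of_mul_pos_right (hf ▸ hf0) (by omega)
    nlinarith

theorem markov_lt_of_linear_bounds {a b m : ℤ} (ha : 0 < a) (hb : 0 < b) (hm : 2 ≤ m)
    (h : a ^ 2 + b ^ 2 + m ^ 2 = 3 * a * b * m) (hab : 3 * b < 4 * (m * a))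
    (hba : 3 * a < 4 * (m * b)) : b < m := by
  by_contra! hmb
  rcases le_total a b with hle | hle
  · exact absurd (markov_largest_bound ha hm hle hmb h) (by omega)
  · exact absurd (markov_largest_bound hb hm hle (hmb.trans hle) (by linarith)) (by omega)

/-! ### Wahl chains splitting a Markov chain -/

theorem exists_isWahlChainOf {n a : ℤ} (ha : 0 < a) (han : a < n) (h : IsCoprime n a) :
    ∃ W, IsWahlChainOf n a W := by
  obtain ⟨W, hW⟩ := exists_isHJChain (p := n ^ 2) (q := n * a - 1) (by nlinarith) (by nlinarith)
  exact ⟨W, ha, han, h, by push_cast at hW; exact hW⟩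

theorem IsWahlChainOf.unique {n a n' a' : ℤ} {W : List ℤ} (h : IsWahlChainOf n a W)
    (h' : IsWahlChainOf n' a' W) : n = n' ∧ a = a' := by
  have hM := h.hjMatrix_eq
  rw [h'.hjMatrix_eq] at hM
  have e0 := congrFun (congrFun hM 0) 0
  have e1 := congrFun (congrFun hM 1) 0
  simp at e0 e1
  have hn : 0 < n := h.1.trans h.2.1
  have hn' : 0 < n' := h'.1.trans h'.2.1
  obtain rfl : n' = n := (pow_left_inj₀ hn'.le hn.le two_ne_zero).1 (by simpa using e0)
  exact ⟨rfl, mul_left_cancel₀ hn.ne' (by linarith)⟩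

theorem isWahlChainOf_five_two : IsWahlChainOf 3 1 [5, 2] :=
  ⟨by norm_num, by norm_num, isCoprime_one_right, by simp, by simp, by norm_num [hjValue]⟩

theorem isWahlChainOf_two_five : IsWahlChainOf 3 2 [2, 5] :=
  ⟨by norm_num, by norm_num, ⟨1, -1, by norm_num⟩, by simp, by simp, by norm_num [hjValue]⟩

section Splitting

variable {m q : ℕ} {x y W₀ W₁ : List ℤ} {n₀ a₀ n₁ a₁ : ℤ}

theorem splitting_lt (h : IsDualHJPair m q x y) (h₀ : IsWahlChainOf n₀ a₀ W₀)
    (h₁ : IsWahlChainOf n₁ a₁ W₁) (he : markovChain x y = W₀ ++ [2] ++ W₁) :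
    n₁ - a₁ < m ∧ a₀ < m := by
  obtain ⟨hmar, k₀, k₁⟩ := (markovChain_eq_iff h h₀ h₁).1 he
  have hq : (0 : ℤ) < q := by exact_mod_cast h.1
  have hqm : (q : ℤ) < m := by exact_mod_cast h.2.1
  have ha₀ : 0 < a₀ := h₀.1
  have hn₀ : a₀ < n₀ := h₀.2.1
  have hn₁ : n₁ - a₁ < n₁ := sub_lt_self _ h₁.1
  have ha₁ : 0 < n₁ - a₁ := sub_pos.2 h₁.2.1
  generalize n₁ - a₁ = a at *
  -- Both bounds come from inserting `n₁ > a` and `n₀ > a₀` in the linear formulas and using `0 < q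
  -- < m`.
  have hab : 3 * a₀ < 4 * (m * a) := by nlinarith
  have hba : 3 * a < 4 * (m * a₀) := by nlinarith
  exact ⟨markov_lt_of_linear_bounds ha₀ ha₁ (by omega) (by linarith) hba hab,
    markov_lt_of_linear_bounds ha₁ ha₀ (by omega) hmar hab hba⟩

theorem splitting_left_eq_five_two_iff (h : IsDualHJPair m q x y) (h₀ : IsWahlChainOf n₀ a₀ W₀)
    (h₁ : IsWahlChainOf n₁ a₁ W₁) (he : markovChain x y = W₀ ++ [2] ++ W₁) :
    W₀ = [5, 2] ↔ a₀ = 1 := by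
  constructor
  · rintro rfl
    exact (h₀.unique isWahlChainOf_five_two).2
  · rintro rfl
    obtain ⟨ha, -⟩ := splitting_lt h h₀ h₁ he
    obtain ⟨hmar, k₀, -⟩ := (markovChain_eq_iff h h₀ h₁).1 he
    have hq : (0 : ℤ) < q := by exact_mod_cast h.1
    have hqm : (q : ℤ) < m := by exact_mod_cast h.2.1
    have ha₁ : 0 < n₁ - a₁ := sub_pos.2 h₁.2.1
    have hn₀ : 1 < n₀ := h₀.2.1
    generalize n₁ - a₁ = a at *
    -- Here `m n₀ = 5m - q - 3a`. The Markov equation with `a < m` gives `m < 3a ≤ 2m`, so `0 < q <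
    -- m` leaves only `n₀ = 3`.
    have hn₀' : n₀ < 5 := by nlinarith
    obtain rfl : n₀ = 3 := by interval_cases n₀ <;> first | rfl | nlinarith
    exact h₀.2.2.2.unique isWahlChainOf_five_two.2.2.2

theorem splitting_right_eq_two_five_iff (h : IsDualHJPair m q x y) (h₀ : IsWahlChainOf n₀ a₀ W₀)
    (h₁ : IsWahlChainOf n₁ a₁ W₁) (he : markovChain x y = W₀ ++ [2] ++ W₁) :
    W₁ = [2, 5] ↔ n₁ - a₁ = 1 := by
  constructor
  · rintro rfl
    have := h₁.unique isWahlChainOf_two_five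
    omega
  · intro ha₁
    obtain ⟨-, ha⟩ := splitting_lt h h₀ h₁ he
    obtain ⟨hmar, -, k₁⟩ := (markovChain_eq_iff h h₀ h₁).1 he
    have hq : (0 : ℤ) < q := by exact_mod_cast h.1
    have hqm : (q : ℤ) < m := by exact_mod_cast h.2.1
    have ha₀ : 0 < a₀ := h₀.1
    have hn₁ : 0 < a₁ := h₁.1
    rw [ha₁] at hmar k₁
    obtain rfl : a₁ = n₁ - 1 := by omega
    have hn₁' : n₁ < 5 := by nlinarith
    have hn₁'' : 1 < n₁ := by omega
    obtain rfl : n₁ = 3 := by interval_cases n₁ <;> first | rfl | nlinarith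
    exact h₁.2.2.2.unique isWahlChainOf_two_five.2.2.2

/-- The Markov triple of a splitting. -/
theorem exists_isMarkovTriple_of_splitting (h : IsDualHJPair m q x y)
    (h₀ : IsWahlChainOf n₀ a₀ W₀) (h₁ : IsWahlChainOf n₁ a₁ W₁)
    (he : markovChain x y = W₀ ++ [2] ++ W₁) :
    ∃ a b : ℕ, (a : ℤ) = n₁ - a₁ ∧ (b : ℤ) = a₀ ∧ IsMarkovTriple a b m ∧ a < m ∧ b < m ∧
      a * q ≡ 3 * b [MOD m] := by
  obtain ⟨ham, hbm⟩ := splitting_lt h h₀ h₁ he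
  obtain ⟨hmar, -, k₁⟩ := (markovChain_eq_iff h h₀ h₁).1 he
  have ha₀ : 0 < a₀ := h₀.1
  have ha₁ : 0 < n₁ - a₁ := sub_pos.2 h₁.2.1
  have hm : 0 < m := h.1.trans h.2.1
  generalize n₁ - a₁ = a at *
  lift a to ℕ using ha₁.le
  lift a₀ to ℕ using ha₀.le
  refine ⟨a, a₀, rfl, rfl, ⟨by exact_mod_cast ha₁, by exact_mod_cast ha₀, hm,
    by exact_mod_cast hmar⟩, by exact_mod_cast ham, by exact_mod_cast hbm, ?_⟩
  rw [← Int.natCast_modEq_iff]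
  push_cast
  exact (Int.modEq_iff_dvd.2 ⟨n₁ - 4 * a, by linear_combination -k₁⟩).symm

/-- Every Markov triple with largest member `m` and the right congruence gives a splitting. -/
theorem exists_splitting_of_isMarkovTriple (h : IsDualHJPair m q x y) {a b : ℕ}
    (hab : IsMarkovTriple a b m) (ha : a < m) (hb : b < m) (hmod : a * q ≡ 3 * b [MOD m]) :
    ∃ (n₀ n₁ : ℤ) (W₀ W₁ : List ℤ), IsWahlChainOf n₀ b W₀ ∧ IsWahlChainOf n₁ (n₁ - a) W₁ ∧
      markovChain x y = W₀ ++ [2] ++ W₁ := by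
  have heq := hab.eq_int
  have hq : (0 : ℤ) < q := by exact_mod_cast h.1
  have hqm : (q : ℤ) < m := by exact_mod_cast h.2.1
  have ham : (a : ℤ) < m := by exact_mod_cast ha
  have hbm : (b : ℤ) < m := by exact_mod_cast hb
  have hm : (0 : ℤ) < m := by omega
  have ha0 : (0 : ℤ) < a := by exact_mod_cast hab.1
  have hb0 : (0 : ℤ) < b := by exact_mod_cast hab.2.1
  rw [← Int.natCast_modEq_iff] at hmod
  push_cast at hmod
  obtain ⟨k, hk⟩ := Int.modEq_iff_dvd.1 hmod.symm
  -- Modulo `m`, `a (qb + 3a) ≡ 3 (a² + b²) ≡ 0`, and `a` is invertible. This makes `n₀` integral.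
  have hdvd : (m : ℤ) ∣ q * b + 3 * a := by
    refine hab.rotate.rotate.isCoprime.dvd_of_dvd_mul_left ⟨b * k + 9 * a * b - 3 * m, ?_⟩
    linear_combination b * hk + 3 * heq
  obtain ⟨l, hl⟩ := hdvd
  have k₀ : m * (5 * b - l) = (5 * (m : ℤ) - q) * b - 3 * a := by linear_combination hl
  have k₁ : m * (4 * a + k) = (4 * (m : ℤ) + q) * a - 3 * b := by linear_combination -hk
  have cop : IsCoprime (a : ℤ) b := hab.isCoprime
  -- Modulo `b`, `m n₀ ≡ -3a`, which is a unit.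
  have hc₀ : IsCoprime (5 * b - l : ℤ) b := by
    have : IsCoprime (m * (5 * b - l) : ℤ) b := by
      have h3 : IsCoprime (3 * a : ℤ) b := hab.rotate.isCoprime_three.symm.mul_left cop
      rw [k₀, show (5 * (m : ℤ) - q) * b - 3 * a = -(3 * a) + b * (5 * m - q) by ring]
      exact h3.neg_left.add_mul_left_left _
    exact this.of_mul_left_right
  have hc₁ : IsCoprime (4 * a + k : ℤ) (4 * a + k - a) := by
    have : IsCoprime (m * (4 * a + k) : ℤ) a := by
      have h3 : IsCoprime (3 * b : ℤ) a := hab.isCoprime_three.symm.mul_left cop.symm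
      rw [k₁, show (4 * (m : ℤ) + q) * a - 3 * b = -(3 * b) + a * (4 * m + q) by ring]
      exact h3.neg_left.add_mul_left_left _
    have h2 := this.of_mul_left_right.neg_right.add_mul_left_right 1
    rwa [show -(a : ℤ) + (4 * a + k) * 1 = 4 * a + k - a by ring] at h2
  have hlt₀ : (b : ℤ) < 5 * b - l := by nlinarith
  have hlt₁ : (a : ℤ) < 4 * a + k := by nlinarith
  obtain ⟨W₀, h₀⟩ := exists_isWahlChainOf hb0 hlt₀ hc₀
  obtain ⟨W₁, h₁⟩ := exists_isWahlChainOf (by omega : 0 < 4 * (a : ℤ) + k - a) (by omega) hc₁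
  refine ⟨_, _, W₀, W₁, h₀, h₁, (markovChain_eq_iff h h₀ h₁).2 ⟨?_, ?_, ?_⟩⟩
  · linear_combination heq
  · linear_combination k₀
  · linear_combination k₁

end Splitting

/-! ### Extremal P-resolutions with middle `(-2)`-curve -/

theorem exists_extremalPResolution {Δ Ω n₀ a₀ n₁ a₁ : ℤ} (hcop : IsCoprime Δ Ω)
    (h₀ : 0 < a₀ ∧ a₀ < n₀ ∧ IsCoprime n₀ a₀) (h₁ : 0 < a₁ ∧ a₁ < n₁ ∧ IsCoprime n₁ a₁)
    (hΔ : Δ = n₀ ^ 2 + n₁ ^ 2 + (n₀ * (n₁ - a₁) + n₁ * a₀) * (n₀ * n₁))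
    (hΩ : Ω = (n₀ * (n₁ - a₁) + n₁ * a₀) * (a₀ * n₁) + n₀ * a₀ - n₁ * (n₁ - a₁) - 1) :
    ∃ R : ExtremalPResolution Δ Ω, R.n₀ = n₀ ∧ R.a₀ = a₀ ∧ R.n₁ = n₁ ∧ R.a₁ = a₁ ∧ R.c = 2 ∧
      R.delta = n₀ * (n₁ - a₁) + n₁ * a₀ := by
  have hn₀ : 0 < n₀ := h₀.1.trans h₀.2.1
  have hn₁ : 0 < n₁ := h₁.1.trans h₁.2.1
  have hδ : 0 < n₀ * (n₁ - a₁) + n₁ * a₀ :=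
    add_pos (mul_pos hn₀ (sub_pos.2 h₁.2.1)) (mul_pos hn₁ h₀.1)
  have hΔ0 : 0 < Δ := by rw [hΔ]; positivity
  have hv : IsCoprime (n₀ ^ 2) (1 - n₀ * a₀) := ⟨a₀ ^ 2, 1 + n₀ * a₀, by ring⟩
  have h01 : IsCoprime (0 : ℤ) 1 := isCoprime_one_right
  have d₀ : latticeDet (0, 1) (n₀ ^ 2, 1 - n₀ * a₀) = n₀ ^ 2 := by simp [latticeDet]
  have d₁ : latticeDet (n₀ ^ 2, 1 - n₀ * a₀) (Δ, -Ω) = n₁ ^ 2 := by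
    simp only [latticeDet]; rw [hΔ, hΩ]; ring
  have d : latticeDet (0, 1) (Δ, -Ω) = Δ := by simp [latticeDet]
  -- The neighbours `z₀`, `z₁` of `v` satisfy `z₀ + z₁ = 2v`; `z₁` also witnesses the type of the
  -- second cone.
  refine ⟨⟨(n₀ ^ 2, 1 - n₀ * a₀), n₀, a₀, n₁, a₁, 2,
    ⟨h01, hcop.neg_right, hΔ0, d, (1, 0), by ext <;> simp⟩, .inl h₀, .inl h₁,
    ⟨h01, hv, by positivity, d₀, (1, 0), by ext <;> simp⟩,
    ⟨hv, hcop.neg_right, by positivity, d₁,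
      (1 + n₀ ^ 2 + n₀ * a₀, 1 - n₀ * a₀ - a₀ ^ 2), ?_⟩,
    ⟨(n₀ ^ 2 - n₀ * a₀ - 1, 1 - n₀ * a₀ + a₀ ^ 2), (1 + n₀ ^ 2 + n₀ * a₀, 1 - n₀ * a₀ - a₀ ^ 2),
      ⟨n₀ ^ 2 - n₀ * a₀ - 1, by nlinarith, by nlinarith, ?_⟩,
      ⟨n₁ * a₁ - 1, by nlinarith, by nlinarith, ?_⟩, ?_⟩, ?_⟩, rfl, rfl, rfl, rfl, rfl, ?_⟩
  · ext <;> simp <;> first | (rw [hΔ]; ring) | (rw [hΩ]; ring)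
  · ext <;> simp <;> ring
  · ext <;> simp <;> first | (rw [hΔ]; ring) | (rw [hΩ]; ring)
  · ext <;> simp <;> ring
  · rw [toricCanonicalDegree, toricSelfInt, d₀, d₁, d, hΔ]
    have hn₀' : (0 : ℚ) < n₀ := by exact_mod_cast hn₀
    have hn₁' : (0 : ℚ) < n₁ := by exact_mod_cast hn₁
    have hδ' : (0 : ℚ) < n₀ * (n₁ - a₁) + n₁ * a₀ := by exact_mod_cast hδ
    push_cast
    have : -(1 / (n₀ : ℚ) ^ 2 + -(n₀ ^ 2 + n₁ ^ 2 + (n₀ * (n₁ - a₁) + n₁ * a₀) * (n₀ * n₁)) /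
        (n₀ ^ 2 * n₁ ^ 2) + 1 / n₁ ^ 2) = (n₀ * (n₁ - a₁) + n₁ * a₀) / (n₀ * n₁) := by
      field_simp
      ring
    rw [this]
    positivity
  · simp only [ExtremalPResolution.delta]; ring

theorem eq_of_dvd_sub_of_mem_range {n s t : ℤ} (h : n ∣ s - t) (hs : 0 ≤ s) (hs' : s < n)
    (ht : 0 ≤ t) (ht' : t < n) : s = t :=
  sub_eq_zero.1 (Int.eq_zero_of_abs_lt_dvd h (by rw [abs_lt]; constructor <;> linarith))

namespace ExtremalPResolution

variable {Δ Ω : ℤ} (R : ExtremalPResolution Δ Ω)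

theorem bounds : 0 ≤ R.a₀ ∧ R.a₀ < R.n₀ ∧ 0 < R.a₁ ∧ R.a₁ ≤ R.n₁ := by
  rcases R.pair₀ with h | h <;> rcases R.pair₁ with h' | h' <;> omega

theorem delta_eq_of_c_eq_two (hc : R.c = 2) :
    R.delta = R.n₀ * (R.n₁ - R.a₁) + R.n₁ * R.a₀ := by
  rw [delta, hc]; ring

/-- The two Wahl singularities determine `Δ`, and determine `Ω` modulo `Δ`. -/
theorem eq_of_c_eq_two (hc : R.c = 2) :
    Δ = R.n₀ ^ 2 + R.n₁ ^ 2 + R.delta * (R.n₀ * R.n₁) ∧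
      ∃ k, Ω = R.delta * (R.a₀ * R.n₁) + R.n₀ * R.a₀ - R.n₁ * (R.n₁ - R.a₁) - 1 - k * Δ := by
  rw [R.delta_eq_of_c_eq_two hc]
  obtain ⟨ha₀, han₀, ha₁, han₁⟩ := R.bounds
  obtain ⟨-, hv, -, d₀, z, hz⟩ := R.wahl₀
  obtain ⟨-, -, -, d₁, z', hz'⟩ := R.wahl₁
  obtain ⟨z₀, z₁, ⟨s, hs, hsn, e₀⟩, ⟨s', hs', hsn', e₁⟩, hsum⟩ := R.middle
  rw [hc] at hsum
  generalize R.v = v at *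
  generalize R.n₀ = n₀ at *
  generalize R.a₀ = a₀ at *
  generalize R.n₁ = n₁ at *
  generalize R.a₁ = a₁ at *
  obtain ⟨v₁, v₂⟩ := v
  obtain ⟨p, r⟩ := z
  obtain ⟨p', r'⟩ := z'
  obtain ⟨p₀, r₀⟩ := z₀
  obtain ⟨p₁, r₁⟩ := z₁
  simp only [latticeDet, Prod.smul_mk, Prod.mk_add_mk, Prod.mk.injEq, smul_eq_mul, mul_one,
    mul_zero, sub_zero, zero_add, add_zero] at *
  subst d₀
  obtain ⟨-, hr⟩ := hz
  -- Adjacency is read here from `v` back to `(0, 1)`, so `s` is the inverse of `n₀ a₀ - 1` modulo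
  -- `n₀²`; at the other cone no inversion occurs.
  have hs_eq : s = n₀ ^ 2 - n₀ * a₀ - 1 := by
    refine eq_of_dvd_sub_of_mem_range (n := n₀ ^ 2) ?_ hs hsn (by nlinarith) (by nlinarith)
    refine ⟨(r₀ - s * r) * (1 + n₀ * a₀) + s * a₀ ^ 2 - 1, ?_⟩
    linear_combination (1 + n₀ * a₀) * e₀.2 - s * (1 + n₀ * a₀) * hr
  have hs'_eq : s' = n₁ * a₁ - 1 := by
    refine eq_of_dvd_sub_of_mem_range (n := n₁ ^ 2) ?_ hs' hsn' (by nlinarith) (by nlinarith)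
    obtain ⟨i, j, hij⟩ := hv
    refine ⟨i * (p₁ - p') + j * (r₁ - r'), ?_⟩
    linear_combination i * (e₁.1 - hz'.1) + j * (e₁.2 - hz'.2) - (s' - (n₁ * a₁ - 1)) * hij
  have hn₀ : n₀ ^ 2 ≠ 0 := pow_ne_zero 2 (by omega)
  have hp₀ : p₀ = s := mul_left_cancel₀ hn₀ (by linarith [e₀.1])
  have hΔ : Δ = n₀ ^ 2 + n₁ ^ 2 + (n₀ * (n₁ - a₁) + n₁ * a₀) * (n₀ * n₁) := by
    have hp₁ : p₁ = 2 * n₀ ^ 2 - (n₀ ^ 2 - n₀ * a₀ - 1) := by linarith [hsum.1]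
    have := e₁.1
    rw [hp₁, hs'_eq] at this
    linear_combination this
  refine ⟨hΔ, r, mul_left_cancel₀ hn₀ ?_⟩
  linear_combination d₁ - Δ * hr - (1 - n₀ * a₀) * hΔ

/-- A large `δ` relative to `Ω` excludes smooth points on `Γ`. -/
theorem singular_of_c_eq_two (hc : R.c = 2) {m : ℤ} (hm : 0 < m) (hδ : R.delta = 3 * m)
    (hΩ0 : 0 ≤ Ω) (hΩΔ : Ω < Δ) (hΩm : Ω < 5 * m ^ 2) :
    (0 < R.a₀ ∧ R.a₀ < R.n₀ ∧ IsCoprime R.n₀ R.a₀) ∧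
      (0 < R.a₁ ∧ R.a₁ < R.n₁ ∧ IsCoprime R.n₁ R.a₁) := by
  obtain ⟨hΔ, k, hΩ⟩ := R.eq_of_c_eq_two hc
  have hd := R.delta_eq_of_c_eq_two hc
  obtain ⟨hb₀, hb₁, hb₂, hb₃⟩ := R.bounds
  rw [hδ] at hd hΔ hΩ
  rcases R.pair₀ with h₀ | ⟨hn₀, ha₀⟩
  · refine ⟨h₀, R.pair₁.resolve_right ?_⟩
    rintro ⟨hn₁, ha₁⟩
    rw [hn₁, ha₁] at hd hΩ
    rw [hn₁] at hΔ
    -- With a smooth second point `δ = a₀`, which makes `Ω` at least `9m²`.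
    have ha₀ : R.a₀ = 3 * m := by linarith
    rw [ha₀] at hΩ hb₁
    have : Ω = 9 * m ^ 2 + R.n₀ * (3 * m) - 1 :=
      eq_of_dvd_sub_of_mem_range (n := Δ) ⟨-k, by linarith⟩ hΩ0 hΩΔ (by nlinarith) (by nlinarith)
    nlinarith
  · exfalso
    rw [hn₀, ha₀] at hd hΩ
    rw [hn₀] at hΔ
    have hn₁ : R.n₁ - R.a₁ = 3 * m := by linarith
    rw [hn₁] at hΩ
    -- Here `Δ = 1 + n₁² + 3m n₁`, so `Ω ≡ -3m n₁ - 1 ≡ n₁²` modulo `Δ`, and `n₁ > 3m`.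
    have : Ω = R.n₁ ^ 2 :=
      eq_of_dvd_sub_of_mem_range (n := Δ) ⟨-(k + 1), by linarith⟩ hΩ0 hΩΔ (by positivity)
        (by nlinarith)
    nlinarith

end ExtremalPResolution

/-! ### The Markov cyclic quotient singularity and its resolutions -/

theorem hjValue_num_den {l : List ℤ} (hne : l ≠ []) (hl : ∀ e ∈ l, 2 ≤ e) :
    (hjValue l).num = hjMatrix l 0 0 ∧ ((hjValue l).den : ℤ) = hjMatrix l 1 0 := by
  have hpos := hjMatrix_one_zero_pos hne hl
  have hcop := Int.isCoprime_iff_nat_coprime.1 (hjMatrix_isCoprime l)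
  rw [hjValue_eq_div hl]
  exact ⟨Rat.num_div_eq_of_coprime hpos hcop, Rat.den_div_eq_of_coprime hpos hcop⟩

theorem IsDualHJPair.num_den {m q : ℕ} {x y : List ℤ} (h : IsDualHJPair m q x y) :
    (hjValue (markovChain x y)).num = 20 * (m : ℤ) ^ 2 + m * q - q ^ 2 - 9 ∧
      ((hjValue (markovChain x y)).den : ℤ) = 4 * (m : ℤ) ^ 2 + m * q - 1 := by
  have hnd := hjValue_num_den (markovChain_ne_nil x y) h.two_le
  rw [h.hjMatrix_eq] at hnd
  exact hnd

section Resolution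

variable {m q : ℕ} {x y W₀ W₁ : List ℤ} {n₀ a₀ n₁ a₁ : ℤ}

theorem exists_markovPResolution (h : IsDualHJPair m q x y) (h₀ : IsWahlChainOf n₀ a₀ W₀)
    (h₁ : IsWahlChainOf n₁ a₁ W₁) (he : markovChain x y = W₀ ++ [2] ++ W₁) :
    ∃ R : MarkovPResolution x y, R.n₀ = n₀ ∧ R.a₀ = a₀ ∧ R.n₁ = n₁ ∧ R.a₁ = a₁ ∧ R.c = 2 ∧
      R.delta = 3 * m := by
  obtain ⟨e0, e1⟩ := (markovChain_eq_iff_column h h₀ h₁).1 he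
  obtain ⟨hmar, k₀, k₁⟩ := (markovChain_eq_iff h h₀ h₁).1 he
  have hm : (m : ℤ) ≠ 0 := by exact_mod_cast (h.1.trans h.2.1).ne'
  have hδ : n₀ * (n₁ - a₁) + n₁ * a₀ = 3 * m := by
    refine mul_left_cancel₀ hm ?_
    linear_combination (n₁ - a₁) * k₀ + a₀ * k₁ - 3 * hmar
  rw [← hδ]
  exact exists_extremalPResolution (Rat.isCoprime_num_den _) ⟨h₀.1, h₀.2.1, h₀.2.2.1⟩
    ⟨h₁.1, h₁.2.1, h₁.2.2.1⟩ (h.num_den.1.trans e0) (h.num_den.2.trans e1)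

theorem markovChain_eq_of_markovPResolution (h : IsDualHJPair m q x y)
    (R : MarkovPResolution x y) (hc : R.c = 2) (h₀ : IsWahlChainOf R.n₀ R.a₀ W₀)
    (h₁ : IsWahlChainOf R.n₁ R.a₁ W₁) : markovChain x y = W₀ ++ [2] ++ W₁ := by
  obtain ⟨hΔ, k, hΩ⟩ := R.eq_of_c_eq_two hc
  rw [R.delta_eq_of_c_eq_two hc] at hΔ hΩ
  have hcol := hjMatrix_column (h₀.two_le_append h₁)
  rw [h₀.hjMatrix_append_two_append h₁] at hcol
  simp only [Matrix.of_apply, Matrix.cons_val', Matrix.cons_val_zero,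
    Matrix.cons_val_one, Matrix.cons_val_fin_one] at hcol
  have hcol' := hjMatrix_column h.two_le
  rw [← (hjValue_num_den (markovChain_ne_nil x y) h.two_le).1,
    ← (hjValue_num_den (markovChain_ne_nil x y) h.two_le).2] at hcol'
  rw [markovChain_eq_iff_column h h₀ h₁, ← h.num_den.1, ← h.num_den.2]
  -- `Ω` is known only modulo `Δ`, but both candidates are lower entries of first columns of chains,
  -- hence in `[0, Δ)`.
  refine ⟨hΔ, eq_of_dvd_sub_of_mem_range (n := (hjValue (markovChain x y)).num)
    ⟨-k, ?_⟩ hcol'.1 hcol'.2 hcol.1 (hcol.2.trans_eq hΔ.symm)⟩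
  linarith

theorem markovPResolution_singular (h : IsDualHJPair m q x y)
    (R : MarkovPResolution x y) (hc : R.c = 2) (hδ : R.delta = 3 * m) :
    (0 < R.a₀ ∧ R.a₀ < R.n₀ ∧ IsCoprime R.n₀ R.a₀) ∧
      (0 < R.a₁ ∧ R.a₁ < R.n₁ ∧ IsCoprime R.n₁ R.a₁) := by
  have hcol := hjMatrix_column h.two_le
  rw [← (hjValue_num_den (markovChain_ne_nil x y) h.two_le).1,
    ← (hjValue_num_den (markovChain_ne_nil x y) h.two_le).2] at hcol
  have hq : (0 : ℤ) < q := by exact_mod_cast h.1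
  have hqm : (q : ℤ) < m := by exact_mod_cast h.2.1
  exact R.singular_of_c_eq_two hc (hq.trans hqm) hδ hcol.1 hcol.2 (by rw [h.num_den.2]; nlinarith)

end Resolution

/-! ### Assembly of the equivalences -/

theorem splitting_iff_isMarkovTriple {m q : ℕ} {x y : List ℤ} (h : IsDualHJPair m q x y) :
    (∃ W₀ W₁ : List ℤ, IsWahlChain W₀ ∧ IsWahlChain W₁ ∧ markovChain x y = W₀ ++ [2] ++ W₁) ↔
      ∃ a b : ℕ, IsMarkovTriple a b m ∧ a < m ∧ b < m ∧ a * q ≡ 3 * b [MOD m] := by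
  constructor
  · rintro ⟨W₀, W₁, ⟨n₀, a₀, h₀⟩, ⟨n₁, a₁, h₁⟩, he⟩
    obtain ⟨a, b, -, -, hab⟩ := exists_isMarkovTriple_of_splitting h h₀ h₁ he
    exact ⟨a, b, hab⟩
  · rintro ⟨a, b, hab, ha, hb, hmod⟩
    obtain ⟨n₀, n₁, W₀, W₁, h₀, h₁, he⟩ := exists_splitting_of_isMarkovTriple h hab ha hb hmod
    exact ⟨W₀, W₁, ⟨_, _, h₀⟩, ⟨_, _, h₁⟩, he⟩

theorem proper_splitting_iff_isMarkovTriple {m q : ℕ} {x y : List ℤ} (h : IsDualHJPair m q x y) :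
    (∃ W₀ W₁ : List ℤ, IsWahlChain W₀ ∧ IsWahlChain W₁ ∧ W₀ ≠ [5, 2] ∧ W₁ ≠ [2, 5] ∧
        markovChain x y = W₀ ++ [2] ++ W₁) ↔
      ∃ a b : ℕ, IsMarkovTriple a b m ∧ 1 < a ∧ a < m ∧ 1 < b ∧ b < m ∧
        a * q ≡ 3 * b [MOD m] := by
  constructor
  · rintro ⟨W₀, W₁, ⟨n₀, a₀, h₀⟩, ⟨n₁, a₁, h₁⟩, hW₀, hW₁, he⟩
    rw [Ne, splitting_left_eq_five_two_iff h h₀ h₁ he] at hW₀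
    rw [Ne, splitting_right_eq_two_five_iff h h₀ h₁ he] at hW₁
    obtain ⟨a, b, ha, hb, hab, ham, hbm, hmod⟩ := exists_isMarkovTriple_of_splitting h h₀ h₁ he
    have h1 := hab.1
    have h2 := hab.2.1
    exact ⟨a, b, hab, by omega, ham, by omega, hbm, hmod⟩
  · rintro ⟨a, b, hab, ha1, ha, hb1, hb, hmod⟩
    obtain ⟨n₀, n₁, W₀, W₁, h₀, h₁, he⟩ := exists_splitting_of_isMarkovTriple h hab ha hb hmod
    refine ⟨W₀, W₁, ⟨_, _, h₀⟩, ⟨_, _, h₁⟩, ?_, ?_, he⟩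
    · rw [Ne, splitting_left_eq_five_two_iff h h₀ h₁ he]
      omega
    · rw [Ne, splitting_right_eq_two_five_iff h h₀ h₁ he]
      omega

theorem splitting_iff_markovPResolution {m q : ℕ} {x y : List ℤ} (h : IsDualHJPair m q x y) :
    (∃ W₀ W₁ : List ℤ, IsWahlChain W₀ ∧ IsWahlChain W₁ ∧ markovChain x y = W₀ ++ [2] ++ W₁) ↔
      ∃ R : MarkovPResolution x y, R.c = 2 ∧ R.delta = 3 * m := by
  constructor
  · rintro ⟨W₀, W₁, ⟨n₀, a₀, h₀⟩, ⟨n₁, a₁, h₁⟩, he⟩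
    obtain ⟨R, -, -, -, -, hR⟩ := exists_markovPResolution h h₀ h₁ he
    exact ⟨R, hR⟩
  · rintro ⟨R, hc, hδ⟩
    obtain ⟨⟨p, p', p''⟩, r, r', r''⟩ := markovPResolution_singular h R hc hδ
    obtain ⟨W₀, h₀⟩ := exists_isWahlChainOf p p' p''
    obtain ⟨W₁, h₁⟩ := exists_isWahlChainOf r r' r''
    exact ⟨W₀, W₁, ⟨_, _, h₀⟩, ⟨_, _, h₁⟩, markovChain_eq_of_markovPResolution h R hc h₀ h₁⟩

theorem exists_isDualHJPair {m q : ℕ} (hq : 0 < q) (hqm : q < m) (h : Nat.Coprime m q) :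
    ∃ x y, IsDualHJPair m q x y := by
  obtain ⟨x, hx⟩ := exists_isHJChain_of_lt q hq m hqm
  obtain ⟨y, hy⟩ := exists_isHJChain_of_lt (m - q) (by omega) m (by omega)
  rw [Nat.cast_sub hqm.le] at hy
  exact ⟨x, y, hq, hqm, h, hx, hy⟩

/-- A Markov triple with largest member `m` has a weight `q` modulo `m`. -/
theorem IsMarkovTriple.exists_weight {a b m : ℕ} (h : IsMarkovTriple a b m) (ha : a < m) :
    ∃ (q : ℕ) (x y : List ℤ), IsDualHJPair m q x y ∧ a * q ≡ 3 * b [MOD m] := by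
  have hm : 1 < m := by have := h.1; omega
  have hma : Nat.Coprime a m := (Nat.isCoprime_iff_coprime.1 h.rotate.rotate.isCoprime).symm
  have hmb : Nat.Coprime m b := (Nat.isCoprime_iff_coprime.1 h.rotate.isCoprime).symm
  have hm3 : Nat.Coprime m 3 :=
    Nat.isCoprime_iff_coprime.1 (by exact_mod_cast h.rotate.rotate.isCoprime_three)
  -- The weight is `q = 3 a⁻¹ b mod m`; it is prime to `m` because 3 and `b` are, and nonzero
  -- because `m > 1`.
  obtain ⟨t, ht⟩ := Nat.exists_mul_mod_eq_one_of_coprime hma hm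
  have hmod : a * (t * (3 * b) % m) ≡ 3 * b [MOD m] := by
    have h1 : a * t ≡ 1 [MOD m] := by rw [Nat.ModEq, ht.2, Nat.mod_eq_of_lt hm]
    calc a * (t * (3 * b) % m) ≡ a * (t * (3 * b)) [MOD m] := (Nat.mod_modEq _ _).mul_left _
      _ = a * t * (3 * b) := by ring
      _ ≡ 1 * (3 * b) [MOD m] := h1.mul_right _
      _ = 3 * b := one_mul _
  have hcop : Nat.Coprime m (t * (3 * b) % m) := by
    have h2 : Nat.Coprime m (a * (t * (3 * b) % m)) := by
      rw [Nat.coprime_iff_gcd_eq_one, Nat.gcd_comm, hmod.gcd_eq, Nat.gcd_comm]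
      exact hm3.mul_right hmb
    exact h2.coprime_mul_left_right
  have hpos : 0 < t * (3 * b) % m := by
    rcases Nat.eq_zero_or_pos (t * (3 * b) % m) with h0 | h0
    · rw [h0, Nat.coprime_zero_right] at hcop
      omega
    · exact h0
  obtain ⟨x, y, hxy⟩ := exists_isDualHJPair hpos (Nat.mod_lt _ (by omega)) hcop
  exact ⟨_, x, y, hxy, hmod⟩

theorem mainTheorem6 (m : ℕ) :
    -- the integers `m` for which some `q` gives a splitting
    ((∃ (q : ℕ) (x y W₀ W₁ : List ℤ), IsDualHJPair m q x y ∧ IsWahlChain W₀ ∧ IsWahlChain W₁ ∧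
        markovChain x y = W₀ ++ [2] ++ W₁) ↔
      ∃ a b : ℕ, IsMarkovTriple a b m ∧ a < m ∧ b < m) ∧
    ((∃ (q : ℕ) (x y W₀ W₁ : List ℤ), IsDualHJPair m q x y ∧ IsWahlChain W₀ ∧ IsWahlChain W₁ ∧
        W₀ ≠ [5, 2] ∧ W₁ ≠ [2, 5] ∧ markovChain x y = W₀ ++ [2] ++ W₁) ↔
      ∃ a b : ℕ, IsMarkovTriple a b m ∧ 1 < a ∧ a < m ∧ 1 < b ∧ b < m) ∧
    -- the pairs `(m, q)`: then `q ≡ 3 a⁻¹ b (mod m)` is a T-weight, `w_m` or `m - w_m`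
    (∀ (q : ℕ) (x y : List ℤ), IsDualHJPair m q x y →
      ((∃ W₀ W₁ : List ℤ, IsWahlChain W₀ ∧ IsWahlChain W₁ ∧
          markovChain x y = W₀ ++ [2] ++ W₁) ↔
        ∃ a b : ℕ, IsMarkovTriple a b m ∧ a < m ∧ b < m ∧ a * q ≡ 3 * b [MOD m]) ∧
      ((∃ W₀ W₁ : List ℤ, IsWahlChain W₀ ∧ IsWahlChain W₁ ∧ W₀ ≠ [5, 2] ∧ W₁ ≠ [2, 5] ∧
          markovChain x y = W₀ ++ [2] ++ W₁) ↔
        ∃ a b : ℕ, IsMarkovTriple a b m ∧ 1 < a ∧ a < m ∧ 1 < b ∧ b < m ∧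
          a * q ≡ 3 * b [MOD m]) ∧
      -- the extremal P-resolutions of the Markov cyclic quotient singularity
      ((∃ W₀ W₁ : List ℤ, IsWahlChain W₀ ∧ IsWahlChain W₁ ∧
          markovChain x y = W₀ ++ [2] ++ W₁) ↔
        ∃ R : MarkovPResolution x y, R.c = 2 ∧ R.delta = 3 * m) ∧
      (∀ (n₀ a₀ n₁ a₁ : ℤ) (W₀ W₁ : List ℤ), IsWahlChainOf n₀ a₀ W₀ → IsWahlChainOf n₁ a₁ W₁ →
        (markovChain x y = W₀ ++ [2] ++ W₁ ↔
          ∃ R : MarkovPResolution x y, R.n₀ = n₀ ∧ R.a₀ = a₀ ∧ R.n₁ = n₁ ∧ R.a₁ = a₁ ∧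
            R.c = 2 ∧ R.delta = 3 * m))) := by
  refine ⟨⟨?_, ?_⟩, ⟨?_, ?_⟩, fun q x y h => ⟨splitting_iff_isMarkovTriple h,
    proper_splitting_iff_isMarkovTriple h, splitting_iff_markovPResolution h, ?_⟩⟩
  · rintro ⟨q, x, y, W₀, W₁, h, hW⟩
    obtain ⟨a, b, hab, ha, hb, -⟩ := (splitting_iff_isMarkovTriple h).1 ⟨W₀, W₁, hW⟩
    exact ⟨a, b, hab, ha, hb⟩
  · rintro ⟨a, b, hab, ha, hb⟩
    obtain ⟨q, x, y, h, hmod⟩ := hab.exists_weight ha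
    obtain ⟨W₀, W₁, hW⟩ := (splitting_iff_isMarkovTriple h).2 ⟨a, b, hab, ha, hb, hmod⟩
    exact ⟨q, x, y, W₀, W₁, h, hW⟩
  · rintro ⟨q, x, y, W₀, W₁, h, hW⟩
    obtain ⟨a, b, hab, ha1, ha, hb1, hb, -⟩ :=
      (proper_splitting_iff_isMarkovTriple h).1 ⟨W₀, W₁, hW⟩
    exact ⟨a, b, hab, ha1, ha, hb1, hb⟩
  · rintro ⟨a, b, hab, ha1, ha, hb1, hb⟩
    obtain ⟨q, x, y, h, hmod⟩ := hab.exists_weight ha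
    obtain ⟨W₀, W₁, hW⟩ :=
      (proper_splitting_iff_isMarkovTriple h).2 ⟨a, b, hab, ha1, ha, hb1, hb, hmod⟩
    exact ⟨q, x, y, W₀, W₁, h, hW⟩
  · intro n₀ a₀ n₁ a₁ W₀ W₁ h₀ h₁
    refine ⟨exists_markovPResolution h h₀ h₁, ?_⟩
    rintro ⟨R, rfl, rfl, rfl, rfl, hc, -⟩
    exact markovChain_eq_of_markovPResolution h R hc h₀ h₁
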